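/- Let $\mathbb{D}=\{z\in\mathbb{C}:|z|<1\}$ be the open unit disc. For $a,z\in\mathbb{D}$ put $\varphi_a(z)=(a-z)/(1-\overline{a}z)$, and for $g$ analytic in $\mathbb{D}$ put $$\|g\|_{H^2}^2=\lim_{r\to1^-}\frac1{2\pi}\int_0^{2\pi}|g(re^{i\theta})|^2\,d\theta\in[0,\infty].$$ An analytic function $f$ in $\mathbb{D}$ belongs to $\mathrm{VMOA}$ if $\|f\circ\varphi_a-f(a)\|_{H^2}^2\to0$ as $|a|\to1^-$. (1) Let $A$ be analytic in $\mathbb{D}$. If $$\sup_{z\in\mathbb{D}}\,|A(z)|\,(1-|z|^2)^2\left(\log\frac{e}{1-|z|}\right)\log\log\frac{e}{1-|z|}<\infty,\qquad(*)$$ then every analytic solution $f$ in $\mathbb{D}$ of the differential equation $f''+Af=0$ belongs to $\mathrm{VMOA}$. (2) Such solutions may be unbounded: there exist a function $A$, analytic in $\mathbb{D}$ and satisfying $(*)$, and an analytic solution $f$ of $f''+Af=0$ in $\mathbb{D}$ that is unbounded in $\mathbb{D}$. -/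

import Mathlib

open Complex Filter Topology MeasureTheory

/-- The open unit disc of the complex plane. -/
abbrev unitDisc : Set ℂ := Metric.ball (0 : ℂ) 1

/-- `f` is an (analytic in the disc) solution of `f'' + A f = 0` in the unit disc. -/
def IsSolution (A f : ℂ → ℂ) : Prop :=
  DifferentiableOn ℂ f unitDisc ∧ ∀ z ∈ unitDisc, deriv (deriv f) z + A z * f z = 0

/-- The coefficient condition
`sup_{z ∈ D} |A(z)| (1 - |z|²)² log (e / (1 - |z|)) log log (e / (1 - |z|)) < ∞`. -/
def LogLogCondition (A : ℂ → ℂ) : Prop :=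
  BddAbove ((fun z : ℂ => ‖A z‖ * (1 - ‖z‖ ^ 2) ^ 2 * Real.log (Real.exp 1 / (1 - ‖z‖)) *
    Real.log (Real.log (Real.exp 1 / (1 - ‖z‖)))) '' unitDisc)

/-- The quadratic integral mean `(2π)⁻¹ ∫_0^{2π} |g(r e^{iθ})|² dθ`, as an extended number. -/
noncomputable def circleMeanSq (g : ℂ → ℂ) (r : ℝ) : ENNReal :=
  ENNReal.ofReal (1 / (2 * Real.pi)) *
    ∫⁻ θ in Set.Icc (0 : ℝ) (2 * Real.pi), ‖g (r * exp (θ * I))‖ₑ ^ 2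

/-- The squared Hardy norm `‖g‖²_{H²} = lim_{r → 1⁻} (2π)⁻¹ ∫_0^{2π} |g(r e^{iθ})|² dθ`.
The integral means of an analytic function increase with `r`, so the upper limit is a limit in
`[0, ∞]`; it is finite exactly if `g ∈ H²`. -/
noncomputable def hardyNormSq (g : ℂ → ℂ) : ENNReal :=
  limsup (circleMeanSq g) (𝓝[<] (1 : ℝ))

/-- The disc automorphism `φ_a(z) = (a - z) / (1 - conj a * z)`. -/
noncomputable def discAut (a z : ℂ) : ℂ := (a - z) / (1 - (starRingEnd ℂ) a * z)

/-- `f ∈ VMOA`: `f` is analytic in the disc and the functions `g_a(z) = f(φ_a(z)) - f(a)` satisfy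
`‖g_a‖²_{H²} → 0` as `|a| → 1⁻`. -/
def IsVMOA (f : ℂ → ℂ) : Prop :=
  DifferentiableOn ℂ f unitDisc ∧
    Tendsto (fun a : ℂ => hardyNormSq (fun z => f (discAut a z) - f a))
      (comap (fun a : ℂ => ‖a‖) (𝓝[<] (1 : ℝ))) (𝓝 0)

/-! Write `L = log (e / (1 - r))`. Since the double logarithm tends to infinity, (*) forces `|A| (1
- r)² L → 0` at the boundary. The function `h = L ^ (1/4)` satisfies `h'' / h = (1/4) (1 - 3 / (4
L)) / ((1 - r)² L)`, so near the boundary it is a supersolution of the radial equation. Comparison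
along radii (`norm_deriv_le_of_supersolution`) gives `|f'| ≤ K h'`, that is, `|f'|² (1 - |z|²)² =
O(L ^ (-3/2))`.

This decay suffices for VMOA (`isVMOA_of_norm_deriv_sq_le`), because `L ^ (-3/2)` is integrable
against `dr / (1 - r)`. Littlewood–Paley bounds the Hardy norm of `g_a = f ∘ φ_a - f(a)` by an area
integral of `|g_a'|²`. As `|φ_a'| (1 - |z|²) = 1 - |φ_a|²`, the integrand is controlled by the
weight evaluated at `1 - |φ_a|²`. A substitute for Jensen's inequality replaces this argument by its
mean over a circle, which is at most `1 - r²` and tends to zero as `|a| → 1`; dominated convergence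
concludes.

For unboundedness, `f = log (4 - log (1 - z))` is a solution with `A = -f'' / f`, and `|A|` is of
order at most `1 / (|1 - z|² s log s)`, where `s = 4 - log |1 - z|`. Monotonicity in the distance
passes from `|1 - z|` to `1 - |z|`. -/

/-! ### Parseval's identity and the Littlewood–Paley estimate -/

/-- The Taylor coefficients at the origin. -/
noncomputable def taylorCoeff (g : ℂ → ℂ) (n : ℕ) : ℂ := (n.factorial : ℂ)⁻¹ * iteratedDeriv n g 0

theorem hasSum_taylorCoeff {g : ℂ → ℂ} (hg : DifferentiableOn ℂ g unitDisc) {z : ℂ}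
    (hz : z ∈ unitDisc) : HasSum (fun n => taylorCoeff g n * z ^ n) (g z) := by
  have := hasSum_taylorSeries_on_ball hg hz
  simp only [sub_zero, smul_eq_mul] at this
  have h : (fun n : ℕ => taylorCoeff g n * z ^ n) =
      fun n : ℕ => (n.factorial : ℂ)⁻¹ * (z ^ n * iteratedDeriv n g 0) := by
    funext n
    rw [taylorCoeff]
    ring
  rwa [h]

theorem taylorCoeff_zero (g : ℂ → ℂ) : taylorCoeff g 0 = g 0 := by
  simp [taylorCoeff]

theorem taylorCoeff_deriv (g : ℂ → ℂ) (n : ℕ) :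
    taylorCoeff (deriv g) n = (n + 1) * taylorCoeff g (n + 1) := by
  have h : (n.factorial : ℂ) ≠ 0 := by exact_mod_cast n.factorial_ne_zero
  have h' : (n : ℂ) + 1 ≠ 0 := by exact_mod_cast n.succ_ne_zero
  simp only [taylorCoeff, iteratedDeriv_succ', Nat.factorial_succ]
  push_cast
  field_simp

theorem integral_exp_nat_mul_conj (m n : ℕ) :
    ∫ θ in Set.Icc (0 : ℝ) (2 * Real.pi),
      exp (θ * I) ^ m * (starRingEnd ℂ) (exp (θ * I) ^ n) = if m = n then 2 * Real.pi else 0 := by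
  have hπ : (0 : ℝ) ≤ 2 * Real.pi := by positivity
  rw [integral_Icc_eq_integral_Ioc, ← intervalIntegral.integral_of_le hπ]
  have key : ∀ θ : ℝ, exp (θ * I) ^ m * (starRingEnd ℂ) (exp (θ * I) ^ n) =
      exp ((((m : ℤ) - n : ℤ) : ℂ) * I * θ) := by
    intro θ
    rw [← exp_nat_mul, ← exp_nat_mul, ← exp_conj, ← exp_add]
    congr 1
    simp
    ring
  simp_rw [key]
  split_ifs with h
  · subst h
    simp
  · have hne : (((m : ℤ) - n : ℤ) : ℂ) ≠ 0 := by
      rw [Int.cast_ne_zero]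
      omega
    rw [integral_exp_mul_complex (mul_ne_zero hne I_ne_zero)]
    have : exp ((((m : ℤ) - n : ℤ) : ℂ) * I * ((2 * Real.pi : ℝ) : ℂ)) = 1 := by
      rw [← exp_int_mul_two_pi_mul_I ((m : ℤ) - n)]
      congr 1
      push_cast
      ring
    rw [this]
    simp

theorem hasSum_mul_of_hasSum {u v : ℕ → ℂ} {s t : ℂ} (h : HasSum u s) (h' : HasSum v t) :
    HasSum (fun p : ℕ × ℕ => u p.1 * v p.2) (s * t) := by
  have hn : Summable fun n => ‖u n‖ := h.summable.norm
  have hn' : Summable fun n => ‖v n‖ := h'.summable.norm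
  exact h.mul h' (summable_mul_of_summable_norm hn hn')

/-- Parseval's identity for the circular means of an analytic function. -/
theorem circleMeanSq_eq_tsum_of_hasSum {g : ℂ → ℂ} (hg : ContinuousOn g unitDisc) {b : ℕ → ℂ}
    (hb : ∀ z ∈ unitDisc, HasSum (fun n => b n * z ^ n) (g z)) {r : ℝ}
    (hr0 : 0 ≤ r) (hr1 : r < 1) :
    circleMeanSq g r = ∑' n, ENNReal.ofReal (‖b n‖ ^ 2 * r ^ (2 * n)) := by
  have hmem : ∀ θ : ℝ, (r : ℂ) * exp (θ * I) ∈ unitDisc := by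
    intro θ
    simp [norm_exp_ofReal_mul_I, abs_of_nonneg hr0, hr1]
  have hs : Summable fun n => ‖b n‖ * r ^ n := by
    have h := (hb _ (hmem 0)).summable.norm
    simpa [abs_of_nonneg hr0] using h
  set c : ℕ → ℂ := fun n => b n * r ^ n with hc
  have hcn : ∀ n, ‖c n‖ = ‖b n‖ * r ^ n := by
    intro n
    simp [hc, abs_of_nonneg hr0]
  set e : ℕ → ℝ → ℂ := fun n θ => exp (θ * I) ^ n with he
  have hen : ∀ n θ, ‖e n θ‖ = 1 := by
    intro n θ
    simp [he, norm_exp_ofReal_mul_I]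
  have hec : ∀ n, Continuous (e n) := by
    intro n
    simp only [he]
    fun_prop
  have hsum : ∀ θ : ℝ, HasSum (fun n => c n * e n θ) (g (r * exp (θ * I))) := by
    intro θ
    have h := hb _ (hmem θ)
    convert h using 2 with n
    simp only [hc, he, mul_pow]
    ring
  have hnormsum : Summable fun n => ‖c n‖ := by simpa only [hcn] using hs
  -- `|g|²` is expanded as a double series. It converges absolutely and uniformly in `θ`, so it may
  -- be integrated termwise; orthogonality leaves the diagonal.
  obtain ⟨F, hF⟩ : ∃ F : ℕ × ℕ → ℝ → ℂ, ∀ p θ,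
      F p θ = (c p.1 * e p.1 θ) * (starRingEnd ℂ) (c p.2 * e p.2 θ) := ⟨_, fun _ _ => rfl⟩
  have hFc : ∀ p, Continuous (F p) := by
    intro p
    have h1 := hec p.1
    have h2 := hec p.2
    rw [show F p = fun θ => _ from funext (hF p)]
    exact (continuous_const.mul h1).mul (continuous_conj.comp (continuous_const.mul h2))
  have hFn : ∀ p θ, ‖F p θ‖ = ‖c p.1‖ * ‖c p.2‖ := by
    intro p θ
    simp [hF, hen]
  have hprod : Summable fun p : ℕ × ℕ => ‖c p.1‖ * ‖c p.2‖ :=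
    hnormsum.mul_of_nonneg hnormsum (fun _ => norm_nonneg _) (fun _ => norm_nonneg _)
  have hFsum : ∀ θ, HasSum (fun p => F p θ)
      (g (r * exp (θ * I)) * (starRingEnd ℂ) (g (r * exp (θ * I)))) := by
    intro θ
    have hconj : HasSum (fun n => (starRingEnd ℂ) (c n * e n θ))
        ((starRingEnd ℂ) (g (r * exp (θ * I)))) := (hsum θ).map (starRingEnd ℂ) continuous_conj
    simp only [hF]
    exact hasSum_mul_of_hasSum (u := fun n => c n * e n θ) (v := fun n => (starRingEnd ℂ) (c n * e n θ)) (hsum θ) hconj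
  set μ : Measure ℝ := volume.restrict (Set.Icc (0 : ℝ) (2 * Real.pi)) with hμ
  have hint : HasSum (fun p => ∫ θ, F p θ ∂μ) (∫ θ, ∑' p, F p θ ∂μ) := by
    apply hasSum_integral_of_summable_integral_norm
    · intro p
      exact (hFc p).integrableOn_Icc
    · simp_rw [hFn]
      simp only [integral_const, smul_eq_mul]
      exact hprod.mul_left _
  have hFint : ∀ p : ℕ × ℕ, ∫ θ, F p θ ∂μ =
      if p.1 = p.2 then ((2 * Real.pi * (‖b p.1‖ ^ 2 * r ^ (2 * p.1)) : ℝ) : ℂ) else 0 := by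
    rintro ⟨m, n⟩
    have : ∀ θ, F (m, n) θ = (c m * (starRingEnd ℂ) (c n)) *
        (exp (θ * I) ^ m * (starRingEnd ℂ) (exp (θ * I) ^ n)) := by
      intro θ
      simp only [hF, he, map_mul]
      ring
    simp_rw [this]
    rw [integral_const_mul, integral_exp_nat_mul_conj]
    by_cases hmn : m = n
    · subst hmn
      simp only [if_true, mul_conj, normSq_eq_norm_sq, hcn]
      push_cast
      ring
    · simp [hmn]
  simp_rw [hFint] at hint
  have hdiag : HasSum (fun n : ℕ => ((2 * Real.pi * (‖b n‖ ^ 2 * r ^ (2 * n)) : ℝ) : ℂ))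
      (∫ θ, ∑' p, F p θ ∂μ) := by
    have hinj : Function.Injective fun n : ℕ => (n, n) := fun m n h => (Prod.mk.inj h).1
    have := (hinj.hasSum_iff (f := fun p : ℕ × ℕ => if p.1 = p.2 then
      ((2 * Real.pi * (‖b p.1‖ ^ 2 * r ^ (2 * p.1)) : ℝ) : ℂ) else 0) ?_).2 hint
    · simpa [Function.comp_def] using this
    · rintro ⟨m, n⟩ h
      rw [if_neg]
      rintro (rfl : m = n)
      exact h ⟨m, rfl⟩
  have hval : ∫ θ, ∑' p, F p θ ∂μ = ((∫ θ, ‖g (r * exp (θ * I))‖ ^ 2 ∂μ : ℝ) : ℂ) := by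
    rw [← integral_complex_ofReal]
    refine integral_congr_ae (Eventually.of_forall fun θ => ?_)
    simp only [(hFsum θ).tsum_eq, mul_conj, normSq_eq_norm_sq]
  rw [hval, hasSum_ofReal] at hdiag
  have hgc : Continuous fun θ : ℝ => g (r * exp (θ * I)) :=
    hg.comp_continuous (by fun_prop) hmem
  have hlin : ∫⁻ θ, ‖g (r * exp (θ * I))‖ₑ ^ 2 ∂μ =
      ENNReal.ofReal (∫ θ, ‖g (r * exp (θ * I))‖ ^ 2 ∂μ) := by
    rw [ofReal_integral_eq_lintegral_ofReal]
    · refine lintegral_congr fun θ => ?_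
      rw [ENNReal.ofReal_pow (norm_nonneg _), ofReal_norm]
    · exact (hgc.norm.pow 2).integrableOn_Icc
    · exact Eventually.of_forall fun θ => by positivity
  unfold circleMeanSq
  rw [hlin, ← ENNReal.ofReal_mul (by positivity)]
  have hfin := hdiag.mul_left (1 / (2 * Real.pi))
  rw [← hfin.tsum_eq, ENNReal.ofReal_tsum_of_nonneg (fun n => by positivity) hfin.summable]
  refine tsum_congr fun n => ?_
  congr 1
  have := Real.pi_pos
  field_simp

theorem circleMeanSq_eq_tsum {g : ℂ → ℂ} (hg : DifferentiableOn ℂ g unitDisc) {r : ℝ}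
    (hr0 : 0 ≤ r) (hr1 : r < 1) :
    circleMeanSq g r = ∑' n, ENNReal.ofReal (‖taylorCoeff g n‖ ^ 2 * r ^ (2 * n)) :=
  circleMeanSq_eq_tsum_of_hasSum hg.continuousOn (fun _ hz => hasSum_taylorCoeff hg hz) hr0 hr1

theorem lintegral_weight_mul_pow (n : ℕ) :
    ∫⁻ r in Set.Ioo (0 : ℝ) 1, ENNReal.ofReal (2 * r * (1 - r ^ 2) * r ^ (2 * n)) =
      ENNReal.ofReal (1 / ((n + 1) * (n + 2))) := by
  rw [← ofReal_integral_eq_lintegral_ofReal]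
  · congr 1
    rw [← integral_Ioc_eq_integral_Ioo, ← intervalIntegral.integral_of_le zero_le_one]
    have : ∀ r : ℝ, 2 * r * (1 - r ^ 2) * r ^ (2 * n) =
        2 * r ^ (2 * n + 1) - 2 * r ^ (2 * n + 3) := by
      intro r
      ring
    simp_rw [this]
    rw [intervalIntegral.integral_sub (Continuous.intervalIntegrable (by fun_prop) _ _) (Continuous.intervalIntegrable (by fun_prop) _ _)]
    simp only [intervalIntegral.integral_const_mul, integral_pow]
    have h1 : (n : ℝ) + 1 ≠ 0 := by positivity
    have h2 : (n : ℝ) + 2 ≠ 0 := by positivity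
    have h3 : 2 * (n : ℝ) + 1 + 1 ≠ 0 := by positivity
    have h4 : 2 * (n : ℝ) + 3 + 1 ≠ 0 := by positivity
    push_cast
    simp
    field_simp
    ring
  · exact (Continuous.integrableOn_Icc (by fun_prop)).mono_set Set.Ioo_subset_Icc_self
  · refine (ae_restrict_iff' measurableSet_Ioo).2 (Eventually.of_forall fun r hr => ?_)
    have h0 : 0 ≤ r := hr.1.le
    have h1 : 0 ≤ 1 - r ^ 2 := by nlinarith [hr.1, hr.2]
    simp only [Pi.zero_apply]
    positivity

/-- The Littlewood–Paley estimate for the Hardy norm. -/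
theorem hardyNormSq_le_lintegral {g : ℂ → ℂ} (hg : DifferentiableOn ℂ g unitDisc) (h0 : g 0 = 0) :
    hardyNormSq g ≤ 2 * ∫⁻ r in Set.Ioo (0 : ℝ) 1,
      ENNReal.ofReal (2 * r * (1 - r ^ 2)) * circleMeanSq (deriv g) r := by
  have hg' : DifferentiableOn ℂ (deriv g) unitDisc := hg.deriv Metric.isOpen_ball
  have hL : hardyNormSq g ≤ ∑' n, ENNReal.ofReal (‖taylorCoeff g n‖ ^ 2) := by
    refine limsup_le_of_le (by isBoundedDefault) ?_
    have : Set.Ioo (0 : ℝ) 1 ∈ 𝓝[<] (1 : ℝ) := Ioo_mem_nhdsLT zero_lt_one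
    filter_upwards [this] with r hr
    rw [circleMeanSq_eq_tsum hg hr.1.le hr.2]
    refine ENNReal.tsum_le_tsum fun n => ENNReal.ofReal_le_ofReal ?_
    exact mul_le_of_le_one_right (by positivity) (pow_le_one₀ hr.1.le hr.2.le)
  refine hL.trans ?_
  rw [tsum_eq_zero_add' ENNReal.summable, taylorCoeff_zero, h0]
  simp only [norm_zero, ne_eq, OfNat.ofNat_ne_zero, not_false_eq_true, zero_pow,
    ENNReal.ofReal_zero, zero_add]
  have hR : ∫⁻ r in Set.Ioo (0 : ℝ) 1,
      ENNReal.ofReal (2 * r * (1 - r ^ 2)) * circleMeanSq (deriv g) r =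
      ∑' n, ENNReal.ofReal (‖taylorCoeff (deriv g) n‖ ^ 2) *
        ENNReal.ofReal (1 / ((n + 1) * (n + 2))) := by
    simp_rw [← lintegral_weight_mul_pow]
    have : ∀ n : ℕ, ENNReal.ofReal (‖taylorCoeff (deriv g) n‖ ^ 2) *
        ∫⁻ r in Set.Ioo (0 : ℝ) 1, ENNReal.ofReal (2 * r * (1 - r ^ 2) * r ^ (2 * n)) =
        ∫⁻ r in Set.Ioo (0 : ℝ) 1, ENNReal.ofReal (‖taylorCoeff (deriv g) n‖ ^ 2) *
          ENNReal.ofReal (2 * r * (1 - r ^ 2) * r ^ (2 * n)) := by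
      intro n
      rw [lintegral_const_mul _ (by fun_prop)]
    simp_rw [this]
    rw [← lintegral_tsum (fun n => by fun_prop)]
    refine setLIntegral_congr_fun measurableSet_Ioo fun r hr => ?_
    have h1 : 0 ≤ 2 * r * (1 - r ^ 2) := by
      have : 0 ≤ 1 - r ^ 2 := by nlinarith [hr.1, hr.2]
      have := hr.1.le
      positivity
    rw [circleMeanSq_eq_tsum hg' hr.1.le hr.2, ← ENNReal.tsum_mul_left]
    refine tsum_congr fun n => ?_
    rw [← ENNReal.ofReal_mul h1, ← ENNReal.ofReal_mul (by positivity)]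
    congr 1
    ring
  rw [hR, ← ENNReal.tsum_mul_left]
  refine ENNReal.tsum_le_tsum fun n => ?_
  rw [← ENNReal.ofReal_mul (by positivity), ← ENNReal.ofReal_ofNat, ← ENNReal.ofReal_mul (by norm_num)]
  refine ENNReal.ofReal_le_ofReal ?_
  have h1 : ‖taylorCoeff (deriv g) n‖ = (n + 1) * ‖taylorCoeff g (n + 1)‖ := by
    rw [taylorCoeff_deriv, norm_mul]
    congr 1
    exact_mod_cast Complex.norm_natCast (n + 1)
  rw [h1]
  have h2 : (0 : ℝ) < n + 1 := by positivity
  have h3 : (0 : ℝ) < n + 2 := by positivity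
  have : 2 * (((n : ℝ) + 1) * ‖taylorCoeff g (n + 1)‖) ^ 2 * (1 / ((n + 1) * (n + 2))) =
      ‖taylorCoeff g (n + 1)‖ ^ 2 * (2 * (n + 1) / (n + 2)) := by
    field_simp
  rw [← mul_assoc, this]
  -- The factor `2` in the estimate is what makes `2 (n + 1) / (n + 2) ≥ 1` for every `n`, with
  -- equality at `n = 0`.
  refine le_mul_of_one_le_right (by positivity) ?_
  rw [le_div_iff₀ h3]
  nlinarith [(Nat.cast_nonneg n : (0 : ℝ) ≤ n)]

/-! ### The logarithmic weight -/

/-- The weight `x ↦ (4 - log x) ^ (-3/2)`, which is increasing on `(0, 1]` and vanishes slowly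
at the origin. -/
noncomputable def logWeight (x : ℝ) : ℝ := (4 - Real.log x) ^ (-(3 / 2) : ℝ)

theorem four_le_sub_log {x : ℝ} (h0 : 0 < x) (h1 : x ≤ 1) : 4 ≤ 4 - Real.log x := by
  linarith [Real.log_nonpos h0.le h1]

theorem logWeight_pos {x : ℝ} (h0 : 0 < x) (h1 : x ≤ 1) : 0 < logWeight x :=
  Real.rpow_pos_of_pos (by linarith [four_le_sub_log h0 h1]) _

theorem logWeight_le_logWeight {x y : ℝ} (h0 : 0 < x) (hxy : x ≤ y) (h1 : y ≤ 1) :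
    logWeight x ≤ logWeight y := by
  refine Real.rpow_le_rpow_of_nonpos ?_ ?_ (by norm_num)
  · linarith [four_le_sub_log (h0.trans_le hxy) h1]
  · linarith [Real.log_le_log h0 hxy]

/-- With `s = 4 - log x` and `t = 4 - log y` one has `y / x = exp (s - t)`, and the claim is `(s /
t) ^ (3/2) ≤ exp (s - t)`. It holds because `t ≥ 4` gives `s / t ≤ 1 + (s - t) / 4`. -/
theorem logWeight_mul_le {x y : ℝ} (h0 : 0 < x) (hxy : x ≤ y) (h1 : y ≤ 1) :
    logWeight y * x ≤ logWeight x * y := by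
  have hy := h0.trans_le hxy
  have ht := four_le_sub_log hy h1
  have hs := four_le_sub_log h0 (hxy.trans h1)
  have hst : 4 - Real.log y ≤ 4 - Real.log x := by linarith [Real.log_le_log h0 hxy]
  have hlog : Real.log y - Real.log x = (4 - Real.log x) - (4 - Real.log y) := by ring
  have hyx : y = x * Real.exp ((4 - Real.log x) - (4 - Real.log y)) := by
    rw [← hlog, Real.exp_sub, Real.exp_log hy, Real.exp_log h0]
    field_simp
  unfold logWeight
  set s := 4 - Real.log x
  set t := 4 - Real.log y
  have ht0 : 0 < t := by linarith
  have hs0 : 0 < s := by linarith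
  have h2 : s ≤ t * Real.exp ((s - t) / 4) := by
    have h3 : (s - t) / 4 + 1 ≤ Real.exp ((s - t) / 4) := Real.add_one_le_exp _
    nlinarith
  have h4 : s ^ (3 / 2 : ℝ) ≤ t ^ (3 / 2 : ℝ) * Real.exp (s - t) := by
    calc s ^ (3 / 2 : ℝ) ≤ (t * Real.exp ((s - t) / 4)) ^ (3 / 2 : ℝ) :=
          Real.rpow_le_rpow hs0.le h2 (by norm_num)
      _ = t ^ (3 / 2 : ℝ) * Real.exp ((s - t) / 4 * (3 / 2)) := by
          rw [Real.mul_rpow ht0.le (Real.exp_pos _).le, ← Real.exp_mul]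
      _ ≤ t ^ (3 / 2 : ℝ) * Real.exp (s - t) := by
          gcongr
          linarith
  rw [Real.rpow_neg ht0.le, Real.rpow_neg hs0.le, hyx]
  have ht' : 0 < t ^ (3 / 2 : ℝ) := Real.rpow_pos_of_pos ht0 _
  have hs' : 0 < s ^ (3 / 2 : ℝ) := Real.rpow_pos_of_pos hs0 _
  rw [inv_mul_eq_div, inv_mul_eq_div, div_le_div_iff₀ ht' hs']
  nlinarith

/-- Substitute for Jensen's inequality: the bound is affine in `x`, so it can be averaged. When `y`
is the mean of `x`, averaging costs only a factor `2`. -/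
theorem logWeight_le_mul_one_add {x y : ℝ} (hx0 : 0 < x) (hx1 : x ≤ 1) (hy0 : 0 < y)
    (hy1 : y ≤ 1) : logWeight x ≤ logWeight y * (1 + x / y) := by
  have hy := logWeight_pos hy0 hy1
  rcases le_total x y with h | h
  · have h1 := logWeight_le_logWeight hx0 h hy1
    have : 0 ≤ x / y := by positivity
    nlinarith
  · have h1 := logWeight_mul_le hy0 h hx1
    have h2 : logWeight x ≤ logWeight y * (x / y) := by
      rw [← mul_div_assoc, le_div_iff₀ hy0]
      exact h1
    nlinarith

/-! ### Disc automorphisms and circular means -/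

theorem norm_lt_one_of_mem {z : ℂ} (hz : z ∈ unitDisc) : ‖z‖ < 1 := by simpa using hz

theorem one_sub_conj_mul_ne_zero {a z : ℂ} (ha : ‖a‖ < 1) (hz : ‖z‖ < 1) :
    1 - (starRingEnd ℂ) a * z ≠ 0 := by
  intro h
  have h1 : ‖(starRingEnd ℂ) a * z‖ = 1 := by
    rw [← sub_eq_zero.1 h, norm_one]
  rw [norm_mul, norm_conj] at h1
  nlinarith [norm_nonneg a, norm_nonneg z]

theorem one_sub_norm_discAut_sq {a z : ℂ} (ha : ‖a‖ < 1) (hz : ‖z‖ < 1) :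
    1 - ‖discAut a z‖ ^ 2 =
      (1 - ‖a‖ ^ 2) * (1 - ‖z‖ ^ 2) / ‖1 - (starRingEnd ℂ) a * z‖ ^ 2 := by
  have h : ‖1 - (starRingEnd ℂ) a * z‖ ≠ 0 := norm_ne_zero_iff.2 (one_sub_conj_mul_ne_zero ha hz)
  rw [discAut, norm_div, div_pow, eq_div_iff (pow_ne_zero 2 h), sub_mul,
    div_mul_cancel₀ _ (pow_ne_zero 2 h)]
  simp only [← normSq_eq_norm_sq, normSq_apply]
  simp
  ring

theorem norm_discAut_lt_one {a z : ℂ} (ha : ‖a‖ < 1) (hz : ‖z‖ < 1) : ‖discAut a z‖ < 1 := by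
  have h : 0 < ‖1 - (starRingEnd ℂ) a * z‖ := norm_pos_iff.2 (one_sub_conj_mul_ne_zero ha hz)
  have h1 : 0 < 1 - ‖a‖ ^ 2 := by nlinarith [norm_nonneg a]
  have h2 : 0 < 1 - ‖z‖ ^ 2 := by nlinarith [norm_nonneg z]
  have h3 : 0 < 1 - ‖discAut a z‖ ^ 2 := by
    rw [one_sub_norm_discAut_sq ha hz]
    positivity
  nlinarith [norm_nonneg (discAut a z)]

theorem hasDerivAt_discAut {a z : ℂ} (ha : ‖a‖ < 1) (hz : ‖z‖ < 1) :
    HasDerivAt (discAut a) (((‖a‖ ^ 2 - 1 : ℝ) : ℂ) / (1 - (starRingEnd ℂ) a * z) ^ 2) z := by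
  have h := one_sub_conj_mul_ne_zero ha hz
  have h1 : HasDerivAt (fun w : ℂ => a - w) (-1) z := by
    simpa using (hasDerivAt_id z).const_sub a
  have h2 : HasDerivAt (fun w : ℂ => 1 - (starRingEnd ℂ) a * w) (-(starRingEnd ℂ) a) z := by
    simpa using ((hasDerivAt_id z).const_mul ((starRingEnd ℂ) a)).const_sub 1
  refine (h1.div h2 h).congr_deriv ?_
  congr 1
  push_cast
  rw [← mul_conj']
  ring

/-- Parseval for the geometric series. Through `one_sub_norm_discAut_sq` this computes the mean of
`1 - |φ_a|²`. -/
theorem circleMeanSq_inv_one_sub {a : ℂ} (ha : ‖a‖ < 1) {r : ℝ} (hr0 : 0 ≤ r) (hr1 : r < 1) :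
    circleMeanSq (fun z => (1 - (starRingEnd ℂ) a * z)⁻¹) r =
      ENNReal.ofReal (1 - ‖a‖ ^ 2 * r ^ 2)⁻¹ := by
  rw [circleMeanSq_eq_tsum_of_hasSum (b := fun n => (starRingEnd ℂ) a ^ n) ?_ ?_ hr0 hr1]
  · have h1 : ‖a‖ ^ 2 * r ^ 2 < 1 := by
      have : ‖a‖ ^ 2 < 1 := by nlinarith [norm_nonneg a]
      have : r ^ 2 < 1 := by nlinarith
      nlinarith [sq_nonneg r, sq_nonneg ‖a‖]
    have h := hasSum_geometric_of_lt_one (by positivity) h1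
    rw [← h.tsum_eq, ENNReal.ofReal_tsum_of_nonneg (fun n => by positivity) h.summable]
    refine tsum_congr fun n => ?_
    congr 1
    rw [norm_pow, norm_conj]
    ring
  · exact ContinuousOn.inv₀ (by fun_prop)
      fun z hz => one_sub_conj_mul_ne_zero ha (norm_lt_one_of_mem hz)
  · intro z hz
    have hz := norm_lt_one_of_mem hz
    have : ‖(starRingEnd ℂ) a * z‖ < 1 := by
      rw [norm_mul, norm_conj]
      nlinarith [norm_nonneg a, norm_nonneg z]
    simpa only [mul_pow] using hasSum_geometric_of_norm_lt_one this

theorem circleMeanSq_le_of_norm_sq_le {g h : ℂ → ℂ} {r B c : ℝ} (hB : 0 ≤ B) (hc : 0 ≤ c)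
    (hgh : ∀ θ : ℝ, ‖g (r * exp (θ * I))‖ ^ 2 ≤ B * (1 + c * ‖h (r * exp (θ * I))‖ ^ 2)) :
    circleMeanSq g r ≤ ENNReal.ofReal B * (1 + ENNReal.ofReal c * circleMeanSq h r) := by
  have hpt : ∀ θ : ℝ, ‖g (r * exp (θ * I))‖ₑ ^ 2 ≤
      ENNReal.ofReal B * (1 + ENNReal.ofReal c * ‖h (r * exp (θ * I))‖ₑ ^ 2) := by
    intro θ
    have := ENNReal.ofReal_le_ofReal (hgh θ)
    rw [ENNReal.ofReal_pow (norm_nonneg _), ofReal_norm, ENNReal.ofReal_mul hB,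
      ENNReal.ofReal_add zero_le_one (by positivity), ENNReal.ofReal_mul hc,
      ENNReal.ofReal_pow (norm_nonneg _), ofReal_norm, ENNReal.ofReal_one] at this
    exact this
  have hle : ∫⁻ θ in Set.Icc (0 : ℝ) (2 * Real.pi), ‖g (r * exp (θ * I))‖ₑ ^ 2 ≤
      ENNReal.ofReal B * (ENNReal.ofReal (2 * Real.pi) + ENNReal.ofReal c *
        ∫⁻ θ in Set.Icc (0 : ℝ) (2 * Real.pi), ‖h (r * exp (θ * I))‖ₑ ^ 2) := by
    refine (lintegral_mono hpt).trans_eq ?_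
    rw [lintegral_const_mul' _ _ ENNReal.ofReal_ne_top, lintegral_add_left measurable_const,
      lintegral_const_mul' _ _ ENNReal.ofReal_ne_top]
    simp
  have hone : ENNReal.ofReal (1 / (2 * Real.pi)) * ENNReal.ofReal (2 * Real.pi) = 1 := by
    rw [← ENNReal.ofReal_mul (by positivity), one_div_mul_cancel (by positivity),
      ENNReal.ofReal_one]
  unfold circleMeanSq
  refine (mul_le_mul_right hle _).trans_eq ?_
  calc _ = ENNReal.ofReal B * (ENNReal.ofReal (1 / (2 * Real.pi)) * ENNReal.ofReal (2 * Real.pi) +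
        ENNReal.ofReal c * (ENNReal.ofReal (1 / (2 * Real.pi)) *
        ∫⁻ θ in Set.Icc (0 : ℝ) (2 * Real.pi), ‖h (r * exp (θ * I))‖ₑ ^ 2)) := by ring
    _ = _ := by rw [hone]

/-- The value of the circular mean of `1 - |φ_a|²` over `|z| = r`. -/
noncomputable def meanDistance (a : ℂ) (r : ℝ) : ℝ :=
  (1 - ‖a‖ ^ 2) * (1 - r ^ 2) / (1 - ‖a‖ ^ 2 * r ^ 2)

theorem meanDistance_pos {a : ℂ} (ha : ‖a‖ < 1) {r : ℝ} (hr0 : 0 ≤ r) (hr1 : r < 1) :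
    0 < meanDistance a r := by
  have h1 : 0 < 1 - ‖a‖ ^ 2 := by nlinarith [norm_nonneg a]
  have h2 : 0 < 1 - r ^ 2 := by nlinarith
  have h3 : 0 < 1 - ‖a‖ ^ 2 * r ^ 2 := by nlinarith [sq_nonneg r, sq_nonneg ‖a‖]
  unfold meanDistance
  positivity

theorem meanDistance_le {a : ℂ} (ha : ‖a‖ < 1) {r : ℝ} (hr0 : 0 ≤ r) (hr1 : r < 1) :
    meanDistance a r ≤ 1 - r ^ 2 := by
  have h1 : 0 < 1 - ‖a‖ ^ 2 := by nlinarith [norm_nonneg a]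
  have h2 : 0 < 1 - r ^ 2 := by nlinarith
  have h3 : 0 < 1 - ‖a‖ ^ 2 * r ^ 2 := by nlinarith [sq_nonneg r, sq_nonneg ‖a‖]
  unfold meanDistance
  rw [div_le_iff₀ h3]
  nlinarith [mul_nonneg (sq_nonneg ‖a‖) (mul_nonneg h2.le h2.le), sq_nonneg r, sq_nonneg ‖a‖]

theorem circleMeanSq_deriv_comp_discAut_le {f : ℂ → ℂ} (hf : DifferentiableOn ℂ f unitDisc)
    {K : ℝ} (hK0 : 0 ≤ K) (hK : ∀ z ∈ unitDisc,
      ‖deriv f z‖ ^ 2 * (1 - ‖z‖ ^ 2) ^ 2 ≤ K * logWeight (1 - ‖z‖ ^ 2))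
    {a : ℂ} (ha : ‖a‖ < 1) {r : ℝ} (hr0 : 0 ≤ r) (hr1 : r < 1) :
    circleMeanSq (deriv fun z => f (discAut a z) - f a) r ≤
      ENNReal.ofReal (2 * K * logWeight (meanDistance a r) / (1 - r ^ 2) ^ 2) := by
  have hm0 := meanDistance_pos ha hr0 hr1
  have hm1 : meanDistance a r ≤ 1 := (meanDistance_le ha hr0 hr1).trans (by nlinarith)
  have h2 : 0 < 1 - r ^ 2 := by nlinarith
  have h1 : 0 < 1 - ‖a‖ ^ 2 := by nlinarith [norm_nonneg a]
  have h3 : 0 < 1 - ‖a‖ ^ 2 * r ^ 2 := by nlinarith [sq_nonneg r, sq_nonneg ‖a‖]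
  have hΛ := logWeight_pos hm0 hm1
  have hB : 0 ≤ K * logWeight (meanDistance a r) / (1 - r ^ 2) ^ 2 := by positivity
  refine (circleMeanSq_le_of_norm_sq_le (h := fun z => (1 - (starRingEnd ℂ) a * z)⁻¹)
    hB h3.le ?_).trans_eq ?_
  · intro θ
    set w : ℂ := r * exp (θ * I) with hw
    have hwr : ‖w‖ = r := by simp [hw, norm_exp_ofReal_mul_I, abs_of_nonneg hr0]
    have hw1 : ‖w‖ < 1 := hwr.trans_lt hr1
    have hφ := norm_discAut_lt_one ha hw1
    have hφm : discAut a w ∈ unitDisc := by simpa using hφ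
    have hd : HasDerivAt (fun z => f (discAut a z) - f a)
        (deriv f (discAut a w) *
          (((‖a‖ ^ 2 - 1 : ℝ) : ℂ) / (1 - (starRingEnd ℂ) a * w) ^ 2)) w :=
      (((hf.differentiableAt (Metric.isOpen_ball.mem_nhds hφm)).hasDerivAt).comp w
        (hasDerivAt_discAut ha hw1)).sub_const _
    have hP := one_sub_norm_discAut_sq ha hw1
    rw [hwr] at hP
    have hKw := hK _ hφm
    have hN : 0 < ‖1 - (starRingEnd ℂ) a * w‖ :=
      norm_pos_iff.2 (one_sub_conj_mul_ne_zero ha hw1)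
    rw [hd.deriv, norm_mul, norm_div, norm_pow, norm_real, Real.norm_eq_abs,
      abs_of_neg (by linarith), neg_sub, norm_inv]
    set P := 1 - ‖discAut a w‖ ^ 2 with hPdef
    set N := ‖1 - (starRingEnd ℂ) a * w‖
    have hP0 : 0 < P := by nlinarith [norm_nonneg (discAut a w)]
    have hP1 : P ≤ 1 := by nlinarith [sq_nonneg ‖discAut a w‖]
    have hΛP := logWeight_le_mul_one_add hP0 hP1 hm0 hm1
    -- This ratio has circular mean `1`, so `1 + P / meanDistance a r` has mean `2`.
    have hratio : P / meanDistance a r = (1 - ‖a‖ ^ 2 * r ^ 2) * N⁻¹ ^ 2 := by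
      rw [hP, meanDistance]
      field_simp
    rw [hratio] at hΛP
    -- Equality case of Schwarz–Pick: the left side is `|φ_a'|`.
    have hphi : (1 - ‖a‖ ^ 2) / N ^ 2 = P / (1 - r ^ 2) := by
      rw [hP]
      field_simp
    rw [hphi, mul_pow, div_pow, ← mul_div_assoc]
    rw [div_mul_eq_mul_div, div_le_div_iff_of_pos_right (by positivity)]
    calc _ ≤ K * logWeight P := hKw
      _ ≤ K * (logWeight (meanDistance a r) * (1 + (1 - ‖a‖ ^ 2 * r ^ 2) * N⁻¹ ^ 2)) := by gcongr
      _ = _ := by ring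
  · rw [circleMeanSq_inv_one_sub ha hr0 hr1, ← ENNReal.ofReal_mul h3.le, mul_inv_cancel₀ h3.ne',
      ENNReal.ofReal_one, one_add_one_eq_two, ← ENNReal.ofReal_ofNat, ← ENNReal.ofReal_mul hB]
    congr 1
    ring

/-! ### A derivative condition sufficient for VMOA -/

theorem tendsto_logWeight_zero : Tendsto logWeight (𝓝[>] 0) (𝓝 0) := by
  have h1 : Tendsto (fun x : ℝ => 4 - Real.log x) (𝓝[>] 0) atTop :=
    tendsto_atTop_add_const_left _ 4 (tendsto_neg_atBot_atTop.comp Real.tendsto_log_nhdsGT_zero)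
  exact (tendsto_rpow_neg_atTop (by norm_num : (0 : ℝ) < 3 / 2)).comp h1

theorem hasDerivAt_logWeight_primitive {r : ℝ} (hr0 : 0 < r) (hr1 : r < 1) :
    HasDerivAt (fun r : ℝ => -2 * (4 - Real.log (1 - r ^ 2)) ^ (-(1 / 2) : ℝ))
      (2 * r * logWeight (1 - r ^ 2) / (1 - r ^ 2)) r := by
  have h2 : 0 < 1 - r ^ 2 := by nlinarith
  have h4 := four_le_sub_log h2 (by nlinarith)
  have hd1 : HasDerivAt (fun r : ℝ => 1 - r ^ 2) (-(2 * r)) r := by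
    simpa using (hasDerivAt_pow 2 r).const_sub 1
  have hd2 := (hd1.log h2.ne').const_sub 4
  have hd3 := (hd2.rpow_const (p := (-(1 / 2) : ℝ)) (Or.inl (by linarith))).const_mul (-2)
  refine hd3.congr_deriv ?_
  unfold logWeight
  rw [show (-(1 / 2) - 1 : ℝ) = -(3 / 2) by norm_num]
  ring

theorem lintegral_logWeight_ne_top :
    ∫⁻ r in Set.Ioo (0 : ℝ) 1, ENNReal.ofReal (2 * r * logWeight (1 - r ^ 2) / (1 - r ^ 2)) ≠ ⊤ := by
  -- The primitive is negative and increasing, so the value `0` at the endpoint keeps it monotone on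
  -- `[0, 1]`; the derivative of a monotone function is integrable.
  set G : ℝ → ℝ := fun r => if r < 1 then -2 * (4 - Real.log (1 - r ^ 2)) ^ (-(1 / 2) : ℝ) else 0
    with hG
  have hmono : MonotoneOn G (Set.uIcc 0 1) := by
    intro x hx y hy hxy
    rw [Set.uIcc_of_le zero_le_one] at hx hy
    simp only [hG]
    have hpos : ∀ r : ℝ, 0 ≤ r → r < 1 → 4 ≤ 4 - Real.log (1 - r ^ 2) := fun r h0 h1 =>
      four_le_sub_log (by nlinarith) (by nlinarith)
    split_ifs with h1 h2 h2
    · have hle : Real.log (1 - y ^ 2) ≤ Real.log (1 - x ^ 2) :=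
        Real.log_le_log (by nlinarith [hy.1]) (by nlinarith [hx.1])
      have := Real.rpow_le_rpow_of_nonpos (z := (-(1 / 2) : ℝ))
        (by linarith [hpos x hx.1 h1] : 0 < 4 - Real.log (1 - x ^ 2))
        (by linarith : 4 - Real.log (1 - x ^ 2) ≤ 4 - Real.log (1 - y ^ 2)) (by norm_num)
      linarith
    · have := Real.rpow_nonneg (by linarith [hpos x hx.1 h1] : 0 ≤ 4 - Real.log (1 - x ^ 2))
        (-(1 / 2))
      linarith
    · exact absurd (hxy.trans_lt h2) h1
    · exact le_rfl
  have hint := hmono.intervalIntegrable_deriv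
  rw [intervalIntegrable_iff_integrableOn_Ioo_of_le zero_le_one] at hint
  have hderiv : ∀ r ∈ Set.Ioo (0 : ℝ) 1,
      deriv G r = 2 * r * logWeight (1 - r ^ 2) / (1 - r ^ 2) := by
    intro r hr
    refine ((hasDerivAt_logWeight_primitive hr.1 hr.2).congr_of_eventuallyEq ?_).deriv
    filter_upwards [Iio_mem_nhds hr.2] with x hx
    exact if_pos hx
  have hint' : IntegrableOn (fun r : ℝ => 2 * r * logWeight (1 - r ^ 2) / (1 - r ^ 2))
      (Set.Ioo 0 1) := hint.congr_fun hderiv measurableSet_Ioo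
  exact hint'.lintegral_lt_top.ne

theorem tendsto_meanDistance {r : ℝ} (hr0 : 0 ≤ r) (hr1 : r < 1) :
    Tendsto (fun a : ℂ => meanDistance a r) (comap (fun a : ℂ => ‖a‖) (𝓝[<] (1 : ℝ)))
      (𝓝[>] 0) := by
  refine tendsto_nhdsWithin_iff.2 ⟨?_, ?_⟩
  · have hc : ContinuousAt (fun t : ℝ => (1 - t ^ 2) * (1 - r ^ 2) / (1 - t ^ 2 * r ^ 2)) 1 := by
      refine ContinuousAt.div (by fun_prop) (by fun_prop) ?_
      nlinarith
    have h := hc.tendsto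
    simp only [one_pow, sub_self, zero_mul, zero_div] at h
    exact (h.mono_left nhdsWithin_le_nhds).comp tendsto_comap
  · have : ∀ᶠ a : ℂ in comap (fun a : ℂ => ‖a‖) (𝓝[<] (1 : ℝ)), ‖a‖ < 1 :=
      tendsto_comap.eventually (eventually_mem_nhdsWithin)
    filter_upwards [this] with a ha
    exact meanDistance_pos ha hr0 hr1

theorem measurable_logWeight : Measurable logWeight := by
  unfold logWeight
  fun_prop

/-- An analytic function whose derivative satisfies
`|f'|² (1 - |z|²)² ≤ K (4 - log (1 - |z|²)) ^ (-3/2)` belongs to `VMOA`. -/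
theorem isVMOA_of_norm_deriv_sq_le {f : ℂ → ℂ} (hf : DifferentiableOn ℂ f unitDisc)
    {K : ℝ} (hK0 : 0 ≤ K) (hK : ∀ z ∈ unitDisc,
      ‖deriv f z‖ ^ 2 * (1 - ‖z‖ ^ 2) ^ 2 ≤ K * logWeight (1 - ‖z‖ ^ 2)) : IsVMOA f := by
  refine ⟨hf, ?_⟩
  set l := comap (fun a : ℂ => ‖a‖) (𝓝[<] (1 : ℝ)) with hl
  have hev : ∀ᶠ a : ℂ in l, ‖a‖ < 1 := tendsto_comap.eventually (eventually_mem_nhdsWithin)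
  have hbound : ∀ a : ℂ, ‖a‖ < 1 → hardyNormSq (fun z => f (discAut a z) - f a) ≤
      2 * (ENNReal.ofReal (2 * K) * ∫⁻ r in Set.Ioo (0 : ℝ) 1,
        ENNReal.ofReal (2 * r * logWeight (meanDistance a r) / (1 - r ^ 2))) := by
    intro a ha
    have hg : DifferentiableOn ℂ (fun z => f (discAut a z) - f a) unitDisc := by
      refine DifferentiableOn.sub_const (hf.comp (fun z hz => ?_) fun z hz => ?_) _
      · exact (hasDerivAt_discAut ha
          (norm_lt_one_of_mem hz)).differentiableAt.differentiableWithinAt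
      · simpa using norm_discAut_lt_one ha (norm_lt_one_of_mem hz)
    refine (hardyNormSq_le_lintegral hg (by simp [discAut])).trans ?_
    rw [← lintegral_const_mul' _ _ ENNReal.ofReal_ne_top]
    gcongr 2 * ?_
    refine setLIntegral_mono' measurableSet_Ioo fun r hr => ?_
    refine (mul_le_mul_right
      (circleMeanSq_deriv_comp_discAut_le hf hK0 hK ha hr.1.le hr.2) _).trans_eq ?_
    have h2 : 0 < 1 - r ^ 2 := by nlinarith [hr.1, hr.2]
    have hr0 := hr.1.le
    rw [← ENNReal.ofReal_mul (by positivity), ← ENNReal.ofReal_mul (by positivity)]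
    congr 1
    field_simp
  -- The weight is increasing and `meanDistance a r ≤ 1 - r ^ 2`, so the integrand at `1 - r ^ 2`
  -- dominates independently of `a`.
  have hlim : Tendsto (fun a : ℂ => ∫⁻ r in Set.Ioo (0 : ℝ) 1,
      ENNReal.ofReal (2 * r * logWeight (meanDistance a r) / (1 - r ^ 2))) l
      (𝓝 (∫⁻ r in Set.Ioo (0 : ℝ) 1, 0)) := by
    refine tendsto_lintegral_filter_of_dominated_convergence _ ?_ ?_ lintegral_logWeight_ne_top ?_
    · refine Eventually.of_forall fun a => ?_
      have : Measurable fun r => logWeight (meanDistance a r) :=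
        measurable_logWeight.comp (by unfold meanDistance; fun_prop)
      fun_prop
    · filter_upwards [hev] with a ha
      refine (ae_restrict_iff' measurableSet_Ioo).2 (Eventually.of_forall fun r hr => ?_)
      have h2 : 0 < 1 - r ^ 2 := by nlinarith [hr.1, hr.2]
      have hr0 := hr.1
      refine ENNReal.ofReal_le_ofReal ?_
      have := logWeight_le_logWeight (meanDistance_pos ha hr.1.le hr.2)
        (meanDistance_le ha hr.1.le hr.2) (by nlinarith)
      gcongr
    · refine (ae_restrict_iff' measurableSet_Ioo).2 (Eventually.of_forall fun r hr => ?_)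
      have h1 := tendsto_logWeight_zero.comp (tendsto_meanDistance hr.1.le hr.2)
      have h2 := (h1.const_mul (2 * r)).div_const (1 - r ^ 2)
      simpa using ENNReal.tendsto_ofReal h2
  rw [lintegral_zero] at hlim
  have hlim2 := ENNReal.Tendsto.const_mul (a := 2)
    (ENNReal.Tendsto.const_mul (a := ENNReal.ofReal (2 * K)) hlim (Or.inr ENNReal.ofReal_ne_top))
    (Or.inr ENNReal.ofNat_ne_top)
  rw [mul_zero, mul_zero] at hlim2
  refine tendsto_of_tendsto_of_tendsto_of_le_of_le' tendsto_const_nhds hlim2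
    (Eventually.of_forall fun a => zero_le) ?_
  filter_upwards [hev] with a ha
  exact hbound a ha

/-! ### A comparison principle -/

/-- Comparison of a solution of `u'' = w`, `‖w‖ ≤ a ‖u‖`, with a supersolution `h` of
`h'' = a h`. -/
theorem norm_deriv_le_of_supersolution {u v w : ℝ → ℂ} {h h₁ h₂ a : ℝ → ℝ} {R T K : ℝ}
    (hu : ∀ r ∈ Set.Ico R T, HasDerivAt u (v r) r) (hv : ∀ r ∈ Set.Ico R T, HasDerivAt v (w r) r)
    (hh : ∀ r ∈ Set.Ico R T, HasDerivAt h (h₁ r) r)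
    (hh₁ : ∀ r ∈ Set.Ico R T, HasDerivAt h₁ (h₂ r) r)
    (ha : ∀ r ∈ Set.Ico R T, 0 ≤ a r) (hw : ∀ r ∈ Set.Ico R T, ‖w r‖ ≤ a r * ‖u r‖)
    (hah : ∀ r ∈ Set.Ico R T, a r * h r ≤ h₂ r) (hK : 0 ≤ K)
    (huR : ‖u R‖ < K * h R) (hvR : ‖v R‖ ≤ K * h₁ R) :
    ∀ r ∈ Set.Ico R T, ‖v r‖ ≤ K * h₁ r := by
  have hstep : ∀ c ∈ Set.Ico R T, (∀ r ∈ Set.Ico R c, ‖u r‖ ≤ K * h r) →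
      ∀ r ∈ Set.Icc R c, ‖v r‖ ≤ K * h₁ r := by
    intro c hc hle
    have hsub : ∀ r ∈ Set.Icc R c, r ∈ Set.Ico R T := fun r hr => ⟨hr.1, hr.2.trans_lt hc.2⟩
    have hsub' : ∀ r ∈ Set.Ico R c, r ∈ Set.Ico R T := fun r hr => hsub r ⟨hr.1, hr.2.le⟩
    refine image_norm_le_of_norm_deriv_right_le_deriv_boundary' (f' := w)
      (B' := fun r => K * h₂ r)
      (fun r hr => (hv r (hsub r hr)).continuousAt.continuousWithinAt)
      (fun r hr => (hv r (hsub' r hr)).hasDerivWithinAt) hvR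
      (fun r hr => ((hh₁ r (hsub r hr)).const_mul K).continuousAt.continuousWithinAt)
      (fun r hr => ((hh₁ r (hsub' r hr)).const_mul K).hasDerivWithinAt) ?_
    intro r hr
    calc ‖w r‖ ≤ a r * ‖u r‖ := hw r (hsub' r hr)
      _ ≤ a r * (K * h r) := mul_le_mul_of_nonneg_left (hle r hr) (ha r (hsub' r hr))
      _ = K * (a r * h r) := by ring
      _ ≤ K * h₂ r := mul_le_mul_of_nonneg_left (hah r (hsub' r hr)) hK
  have hmain : ∀ r ∈ Set.Ico R T, ‖u r‖ ≤ K * h r := by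
    intro r₁ hr₁
    by_contra hcon
    rw [not_le] at hcon
    have hsub : ∀ r ∈ Set.Icc R r₁, r ∈ Set.Ico R T := fun r hr => ⟨hr.1, hr.2.trans_lt hr₁.2⟩
    have hcu : ContinuousOn u (Set.Icc R r₁) := fun r hr =>
      (hu r (hsub r hr)).continuousAt.continuousWithinAt
    have hch : ContinuousOn (fun r => K * h r) (Set.Icc R r₁) := fun r hr =>
      ((hh r (hsub r hr)).const_mul K).continuousAt.continuousWithinAt
    have hclosed : IsClosed {r ∈ Set.Icc R r₁ | K * h r ≤ ‖u r‖} :=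
      isClosed_Icc.isClosed_le hch hcu.norm
    have hcompact : IsCompact {r ∈ Set.Icc R r₁ | K * h r ≤ ‖u r‖} :=
      isCompact_Icc.of_isClosed_subset hclosed fun r hr => hr.1
    -- At the first contact point `c`, integrating `‖v‖ ≤ K h₁` from `R` to `c` preserves the strict
    -- initial inequality, so `‖u c‖ < K h c`, a contradiction.
    obtain ⟨c, ⟨hc, hcK⟩, hleast⟩ :=
      hcompact.exists_isLeast ⟨r₁, ⟨hr₁.1, le_rfl⟩, hcon.le⟩
    have hbelow : ∀ r ∈ Set.Ico R c, ‖u r‖ ≤ K * h r := by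
      intro r hr
      by_contra hr'
      exact (hr.2.trans_le (hleast ⟨⟨hr.1, hr.2.le.trans hc.2⟩, (not_le.1 hr').le⟩)).false
    have hvle := hstep c (hsub c hc) hbelow
    have hsubc : ∀ r ∈ Set.Icc R c, r ∈ Set.Ico R T := fun r hr =>
      hsub r ⟨hr.1, hr.2.trans hc.2⟩
    have hfin := image_norm_le_of_norm_deriv_right_le_deriv_boundary'
      (f := fun r => u r - u R) (f' := v) (B := fun r => K * h r - K * h R)
      (B' := fun r => K * h₁ r) (a := R) (b := c)
      (fun r hr => ((hu r (hsubc r hr)).sub_const _).continuousAt.continuousWithinAt)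
      (fun r hr => ((hu r (hsubc r ⟨hr.1, hr.2.le⟩)).sub_const _).hasDerivWithinAt)
      (by simp)
      (fun r hr => (((hh r (hsubc r hr)).const_mul K).sub_const _).continuousAt.continuousWithinAt)
      (fun r hr =>
        (((hh r (hsubc r ⟨hr.1, hr.2.le⟩)).const_mul K).sub_const _).hasDerivWithinAt)
      (fun r hr => hvle r ⟨hr.1, hr.2.le⟩) (Set.right_mem_Icc.2 hc.1)
    have htri : ‖u c‖ ≤ ‖u c - u R‖ + ‖u R‖ := by
      simpa using norm_add_le (u c - u R) (u R)
    linarith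
  intro r hr
  exact hstep r hr (fun s hs => hmain s ⟨hs.1, hs.2.trans hr.2⟩) r ⟨hr.1, le_rfl⟩

/-! ### Growth of the derivative of a solution -/

theorem hasDerivAt_one_sub_log {r : ℝ} (hr : r < 1) :
    HasDerivAt (fun r : ℝ => 1 - Real.log (1 - r)) (1 / (1 - r)) r := by
  have h := (((hasDerivAt_id r).const_sub 1).log (by simp only [id]; linarith)).const_sub 1
  refine h.congr_deriv ?_
  simp [neg_div]

theorem one_le_one_sub_log {r : ℝ} (h0 : 0 ≤ r) (h1 : r < 1) : 1 ≤ 1 - Real.log (1 - r) := by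
  linarith [Real.log_nonpos (by linarith : (0 : ℝ) ≤ 1 - r) (by linarith)]

/-- The comparison function. An exponent `p` yields the decay `L ^ (2p - 2)` for `|f'|² (1 - r)²`,
integrable against `dr / (1 - r)` exactly if `p < 1/2`; here `p = 1/4`. -/
theorem hasDerivAt_one_sub_log_rpow {r : ℝ} (h0 : 0 ≤ r) (h1 : r < 1) :
    HasDerivAt (fun r : ℝ => (1 - Real.log (1 - r)) ^ (1 / 4 : ℝ))
      (1 / 4 * (1 - Real.log (1 - r)) ^ (-(3 / 4) : ℝ) / (1 - r)) r := by
  have hL := one_le_one_sub_log h0 h1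
  refine ((hasDerivAt_one_sub_log h1).rpow_const (Or.inl (by linarith))).congr_deriv ?_
  rw [show (1 / 4 - 1 : ℝ) = -(3 / 4) by norm_num]
  ring

theorem hasDerivAt_deriv_one_sub_log_rpow {r : ℝ} (h0 : 0 ≤ r) (h1 : r < 1) :
    HasDerivAt (fun r : ℝ => 1 / 4 * (1 - Real.log (1 - r)) ^ (-(3 / 4) : ℝ) / (1 - r))
      (1 / 4 * (1 - Real.log (1 - r)) ^ (-(3 / 4) : ℝ) *
        (1 - 3 / 4 / (1 - Real.log (1 - r))) / (1 - r) ^ 2) r := by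
  have hL := one_le_one_sub_log h0 h1
  have hr : 1 - r ≠ 0 := by linarith
  have hd := ((hasDerivAt_one_sub_log h1).rpow_const (p := (-(3 / 4) : ℝ))
    (Or.inl (by linarith))).const_mul (1 / 4)
  have hd2 : HasDerivAt (fun r : ℝ => 1 - r) (-1) r := by
    simpa using (hasDerivAt_id r).const_sub 1
  refine (hd.div hd2 hr).congr_deriv ?_
  rw [Real.rpow_sub_one (by linarith)]
  field_simp
  ring

theorem log_exp_one_div {r : ℝ} (h1 : r < 1) :
    Real.log (Real.exp 1 / (1 - r)) = 1 - Real.log (1 - r) := by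
  rw [Real.log_div (Real.exp_ne_zero 1) (by linarith), Real.log_exp]

theorem LogLogCondition.exists_radius {A : ℂ → ℂ} (hA : LogLogCondition A) {δ : ℝ} (hδ : 0 < δ) :
    ∃ R : ℝ, 0 < R ∧ R < 1 ∧ ∀ z : ℂ, R ≤ ‖z‖ → ‖z‖ < 1 →
      2 ≤ 1 - Real.log (1 - ‖z‖) ∧
      ‖A z‖ * (1 - ‖z‖) ^ 2 * (1 - Real.log (1 - ‖z‖)) ≤ δ := by
  obtain ⟨M, hM⟩ := hA
  set T := |M| / δ + 1 with hT
  have hT1 : 1 ≤ T := by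
    have : 0 ≤ |M| / δ := by positivity
    linarith
  have hexpT : 2 ≤ Real.exp T := by linarith [Real.add_one_le_exp T]
  -- Beyond this radius `L ≥ exp T`, hence `log L ≥ T ≥ |M| / δ`: the double logarithm absorbs the
  -- supremum `M`.
  refine ⟨1 - Real.exp (1 - Real.exp T), ?_, ?_, fun z hz hz1 => ?_⟩
  · have : Real.exp (1 - Real.exp T) < 1 := by simpa using Real.exp_lt_exp.2 (by linarith : 1 - Real.exp T < 0)
    linarith
  · linarith [Real.exp_pos (1 - Real.exp T)]
  · have h1 : 0 < 1 - ‖z‖ := by linarith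
    have hlog : Real.log (1 - ‖z‖) ≤ 1 - Real.exp T := by
      rw [Real.log_le_iff_le_exp h1]
      linarith
    have hb := hM ⟨z, by simpa using hz1, rfl⟩
    simp only [log_exp_one_div hz1] at hb
    set L := 1 - Real.log (1 - ‖z‖) with hL
    have hLT : Real.exp T ≤ L := by linarith
    have hL2 : 2 ≤ L := hexpT.trans hLT
    have hlogL : T ≤ Real.log L := (Real.le_log_iff_exp_le (by linarith)).2 hLT
    refine ⟨hL2, ?_⟩
    have hlogL0 : 0 < Real.log L := by linarith
    have hle : ‖A z‖ * (1 - ‖z‖) ^ 2 * L ≤ ‖A z‖ * (1 - ‖z‖ ^ 2) ^ 2 * L := by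
      have : 1 - ‖z‖ ≤ 1 - ‖z‖ ^ 2 := by nlinarith [norm_nonneg z]
      gcongr
    have h2 : ‖A z‖ * (1 - ‖z‖) ^ 2 * L * Real.log L ≤ M :=
      (mul_le_mul_of_nonneg_right hle hlogL0.le).trans hb
    have h3 : M ≤ δ * Real.log L := by
      calc M ≤ |M| := le_abs_self M
        _ = δ * (|M| / δ) := by field_simp
        _ ≤ δ * Real.log L := by
          gcongr
          linarith
    exact le_of_mul_le_mul_right (h2.trans h3) hlogL0

theorem IsSolution.exists_norm_deriv_le {A f : ℂ → ℂ} (hA : LogLogCondition A)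
    (hf : IsSolution A f) :
    ∃ R K : ℝ, 0 < R ∧ R < 1 ∧ 0 ≤ K ∧ ∀ z : ℂ, R ≤ ‖z‖ → ‖z‖ < 1 →
      ‖deriv f z‖ ≤ K * (1 / 4 * (1 - Real.log (1 - ‖z‖)) ^ (-(3 / 4) : ℝ) / (1 - ‖z‖)) := by
  -- For `L ≥ 2` one has `1 - 3 / (4 L) ≥ 1 / 2`, so `h'' (1 - r)² L / h ≥ 1 / 8`.
  obtain ⟨R, hR0, hR1, hR⟩ := hA.exists_radius (by norm_num : (0 : ℝ) < 1 / 8)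
  obtain ⟨hfd, hode⟩ := hf
  have hfd' : DifferentiableOn ℂ (deriv f) unitDisc := hfd.deriv Metric.isOpen_ball
  have hsub : Metric.closedBall (0 : ℂ) R ⊆ unitDisc := Metric.closedBall_subset_ball hR1
  obtain ⟨B₀, hB₀⟩ := (isCompact_closedBall (0 : ℂ) R).exists_bound_of_continuousOn
    (hfd.continuousOn.mono hsub)
  obtain ⟨B₁, hB₁⟩ := (isCompact_closedBall (0 : ℂ) R).exists_bound_of_continuousOn
    (hfd'.continuousOn.mono hsub)
  set h : ℝ → ℝ := fun r => (1 - Real.log (1 - r)) ^ (1 / 4 : ℝ) with hh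
  set h₁ : ℝ → ℝ := fun r => 1 / 4 * (1 - Real.log (1 - r)) ^ (-(3 / 4) : ℝ) / (1 - r) with hh₁
  have hLR := one_le_one_sub_log hR0.le hR1
  have hhR : 0 < h R := Real.rpow_pos_of_pos (by linarith) _
  have hh₁R : 0 < h₁ R := by
    have := Real.rpow_pos_of_pos (by linarith : 0 < 1 - Real.log (1 - R)) (-(3 / 4))
    have : 0 < 1 - R := by linarith
    simp only [hh₁]
    positivity
  -- Each summand secures one initial inequality; the `+ 1` makes the first strict, uniformly over
  -- directions.
  set K := (|B₀| + 1) / h R + |B₁| / h₁ R with hK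
  have hK0 : 0 ≤ K := by positivity
  have hKh : |B₀| < K * h R := by
    have h1 : (|B₀| + 1) / h R * h R = |B₀| + 1 := by field_simp
    have h2 : 0 ≤ |B₁| / h₁ R * h R := by positivity
    rw [hK, add_mul]
    linarith
  have hKh₁ : |B₁| ≤ K * h₁ R := by
    have h1 : |B₁| / h₁ R * h₁ R = |B₁| := by field_simp
    have h2 : 0 ≤ (|B₀| + 1) / h R * h₁ R := by positivity
    rw [hK, add_mul]
    linarith
  refine ⟨R, K, hR0, hR1, hK0, fun z hz hz1 => ?_⟩
  have hz0 : ‖z‖ ≠ 0 := (hR0.trans_le hz).ne'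
  set ζ : ℂ := z / ‖z‖ with hζ
  have hζ1 : ‖ζ‖ = 1 := by
    rw [hζ, norm_div, norm_real, norm_norm, div_self hz0]
  have hzζ : (‖z‖ : ℂ) * ζ = z := by
    rw [hζ, mul_div_cancel₀]
    exact_mod_cast hz0
  have hnorm : ∀ r ∈ Set.Ico R 1, ‖(r : ℂ) * ζ‖ = r := by
    intro r hr
    rw [norm_mul, hζ1, mul_one, norm_real, Real.norm_eq_abs, abs_of_nonneg (hR0.le.trans hr.1)]
  have hmem : ∀ r ∈ Set.Ico R 1, (r : ℂ) * ζ ∈ unitDisc := by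
    intro r hr
    rw [mem_ball_zero_iff, hnorm r hr]
    exact hr.2
  have hline : ∀ r : ℝ, HasDerivAt (fun r : ℝ => (r : ℂ) * ζ) ζ r := by
    intro r
    simpa using (hasDerivAt_id r).ofReal_comp.mul_const ζ
  have hRmem : R ∈ Set.Ico R 1 := ⟨le_rfl, hR1⟩
  have hRball : (R : ℂ) * ζ ∈ Metric.closedBall (0 : ℂ) R := by
    rw [mem_closedBall_zero_iff, hnorm R hRmem]
  have key := norm_deriv_le_of_supersolution (R := R) (T := 1) (K := K)
    (u := fun r => f (r * ζ)) (v := fun r => deriv f (r * ζ) * ζ)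
    (w := fun r => deriv (deriv f) (r * ζ) * ζ * ζ) (h := h) (h₁ := h₁)
    (h₂ := fun r => 1 / 4 * (1 - Real.log (1 - r)) ^ (-(3 / 4) : ℝ) *
        (1 - 3 / 4 / (1 - Real.log (1 - r))) / (1 - r) ^ 2)
    (a := fun r => ‖A (r * ζ)‖) ?_ ?_ ?_ ?_ ?_ ?_ ?_ hK0 ?_ ?_ ‖z‖ ⟨hz, hz1⟩
  · simpa only [hzζ, norm_mul, hζ1, mul_one] using key
  · intro r hr
    exact (hfd.differentiableAt (Metric.isOpen_ball.mem_nhds (hmem r hr))).hasDerivAt.comp_of_eq r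
      (hline r) rfl
  · intro r hr
    exact ((hfd'.differentiableAt
      (Metric.isOpen_ball.mem_nhds (hmem r hr))).hasDerivAt.comp_of_eq r (hline r) rfl).mul_const ζ
  · exact fun r hr => hasDerivAt_one_sub_log_rpow (hR0.le.trans hr.1) hr.2
  · exact fun r hr => hasDerivAt_deriv_one_sub_log_rpow (hR0.le.trans hr.1) hr.2
  · exact fun r _ => norm_nonneg _
  · intro r hr
    have := hode _ (hmem r hr)
    rw [eq_neg_of_add_eq_zero_left this]
    simp [hζ1]
  · intro r hr
    have hr1 : 0 < 1 - r := by linarith [hr.2]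
    obtain ⟨hL2, hAle⟩ := hR (r * ζ) (by rw [hnorm r hr]; exact hr.1)
      (by rw [hnorm r hr]; exact hr.2)
    rw [hnorm r hr] at hL2 hAle
    simp only [hh]
    set L := 1 - Real.log (1 - r)
    have hL0 : 0 < L := by linarith
    have hLp : 0 < L ^ (-(3 / 4) : ℝ) := Real.rpow_pos_of_pos hL0 _
    have hLq : L ^ (1 / 4 : ℝ) = L * L ^ (-(3 / 4) : ℝ) := by
      rw [← Real.rpow_one_add' hL0.le (by norm_num)]
      norm_num
    rw [hLq, le_div_iff₀ (by positivity)]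
    have h34 : 3 / 4 / L ≤ 1 / 2 := by
      rw [div_le_iff₀ hL0]
      linarith
    calc ‖A (r * ζ)‖ * (L * L ^ (-(3 / 4) : ℝ)) * (1 - r) ^ 2
        = (‖A (r * ζ)‖ * (1 - r) ^ 2 * L) * L ^ (-(3 / 4) : ℝ) := by ring
      _ ≤ 1 / 8 * L ^ (-(3 / 4) : ℝ) := by gcongr
      _ = 1 / 4 * L ^ (-(3 / 4) : ℝ) * (1 - 1 / 2) := by ring
      _ ≤ 1 / 4 * L ^ (-(3 / 4) : ℝ) * (1 - 3 / 4 / L) := by gcongr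
  · exact ((hB₀ _ hRball).trans (le_abs_self _)).trans_lt hKh
  · simp only [norm_mul, hζ1, mul_one]
    exact ((hB₁ _ hRball).trans (le_abs_self _)).trans hKh₁

/-! ### Solutions belong to VMOA -/

theorem isVMOA_of_logLogCondition {A f : ℂ → ℂ} (hA : LogLogCondition A) (hf : IsSolution A f) :
    IsVMOA f := by
  obtain ⟨R, K, hR0, hR1, hK0, hK⟩ := hf.exists_norm_deriv_le hA
  have hfd' : DifferentiableOn ℂ (deriv f) unitDisc := hf.1.deriv Metric.isOpen_ball
  obtain ⟨B, hB⟩ := (isCompact_closedBall (0 : ℂ) R).exists_bound_of_continuousOn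
    (hfd'.continuousOn.mono (Metric.closedBall_subset_ball hR1))
  have hR2 : 0 < 1 - R ^ 2 := by nlinarith
  have hΛR : 0 < logWeight (1 - R ^ 2) := logWeight_pos hR2 (by nlinarith)
  refine isVMOA_of_norm_deriv_sq_le hf.1 (K := B ^ 2 / logWeight (1 - R ^ 2) + 2 * K ^ 2)
    (by positivity) fun z hz => ?_
  have hz1 := norm_lt_one_of_mem hz
  have hz0 := norm_nonneg z
  have hx0 : 0 < 1 - ‖z‖ ^ 2 := by nlinarith
  have hx1 : 1 - ‖z‖ ^ 2 ≤ 1 := by nlinarith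
  have hΛ := logWeight_pos hx0 hx1
  rw [add_mul]
  rcases le_total ‖z‖ R with hzR | hzR
  · have hBz := hB z (by simpa using hzR)
    have hΛle : logWeight (1 - R ^ 2) ≤ logWeight (1 - ‖z‖ ^ 2) :=
      logWeight_le_logWeight hR2 (by nlinarith) hx1
    have h1 : ‖deriv f z‖ ^ 2 * (1 - ‖z‖ ^ 2) ^ 2 ≤ B ^ 2 * 1 :=
      mul_le_mul (pow_le_pow_left₀ (norm_nonneg _) hBz 2) (pow_le_one₀ hx0.le hx1)
        (by positivity) (by positivity)
    have h2 : B ^ 2 * 1 ≤ B ^ 2 / logWeight (1 - R ^ 2) * logWeight (1 - ‖z‖ ^ 2) := by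
      rw [div_mul_eq_mul_div, mul_div_assoc]
      gcongr
      rwa [le_div_iff₀ hΛR, one_mul]
    have h3 : 0 ≤ 2 * K ^ 2 * logWeight (1 - ‖z‖ ^ 2) := by positivity
    linarith
  · have hfz := hK z hzR hz1
    have hL1 := one_le_one_sub_log hz0 hz1
    have hz2 : 0 < 1 - ‖z‖ := by linarith
    have hlog : Real.log (1 - ‖z‖) ≤ Real.log (1 - ‖z‖ ^ 2) :=
      Real.log_le_log hz2 (by nlinarith)
    -- This follows from `4 - log (1 - |z|²) ≤ 4 L` and `4 ^ (-3/2) = 1 / 8`.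
    have hΛge : 1 / 8 * ((1 - Real.log (1 - ‖z‖)) ^ (-(3 / 4) : ℝ)) ^ 2 ≤
        logWeight (1 - ‖z‖ ^ 2) := by
      have h4 := four_le_sub_log hx0 hx1
      unfold logWeight
      set L := 1 - Real.log (1 - ‖z‖) with hL
      have hL0 : 0 ≤ L := by linarith
      have h5 : (4 * L) ^ (-(3 / 2) : ℝ) ≤ (4 - Real.log (1 - ‖z‖ ^ 2)) ^ (-(3 / 2) : ℝ) :=
        Real.rpow_le_rpow_of_nonpos (by linarith) (by linarith) (by norm_num)
      have h6 : (4 : ℝ) ^ (-(3 / 2) : ℝ) = 1 / 8 := by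
        rw [show (4 : ℝ) = 2 ^ (2 : ℝ) by norm_num, ← Real.rpow_mul (by norm_num),
          show (2 * -(3 / 2) : ℝ) = -(3 : ℕ) by norm_num, Real.rpow_neg (by norm_num),
          Real.rpow_natCast]
        norm_num
      have h7 : (L ^ (-(3 / 4) : ℝ)) ^ 2 = L ^ (-(3 / 2) : ℝ) := by
        rw [← Real.rpow_mul_natCast hL0]
        norm_num
      rw [h7, ← h6, ← Real.mul_rpow (by norm_num) hL0]
      exact h5
    set S := (1 - Real.log (1 - ‖z‖)) ^ (-(3 / 4) : ℝ) with hS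
    have h1 : ‖deriv f z‖ * (1 - ‖z‖ ^ 2) ≤ K * (1 / 2 * S) := by
      have hS0 : 0 ≤ S := Real.rpow_nonneg (by linarith) _
      calc ‖deriv f z‖ * (1 - ‖z‖ ^ 2) ≤ K * (1 / 4 * S / (1 - ‖z‖)) * (1 - ‖z‖ ^ 2) := by gcongr
        _ = K * (1 / 4 * S) * (1 + ‖z‖) := by
          field_simp
          ring
        _ ≤ K * (1 / 4 * S) * 2 := by
          gcongr
          linarith
        _ = K * (1 / 2 * S) := by ring
    have h2 : ‖deriv f z‖ ^ 2 * (1 - ‖z‖ ^ 2) ^ 2 ≤ (K * (1 / 2 * S)) ^ 2 := by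
      rw [← mul_pow]
      exact pow_le_pow_left₀ (by positivity) h1 2
    have h3 : (K * (1 / 2 * S)) ^ 2 = 2 * K ^ 2 * (1 / 8 * S ^ 2) := by ring
    have h4 : 2 * K ^ 2 * (1 / 8 * S ^ 2) ≤ 2 * K ^ 2 * logWeight (1 - ‖z‖ ^ 2) := by gcongr
    have h5 : 0 ≤ B ^ 2 / logWeight (1 - R ^ 2) * logWeight (1 - ‖z‖ ^ 2) := by positivity
    linarith

/-! ### An unbounded solution -/

/-- The function `4 - log (1 - z)`, with values in the half-plane `re > 3`. -/
noncomputable def shiftedLog (z : ℂ) : ℂ := 4 - Complex.log (1 - z)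

theorem shiftedLog_re (z : ℂ) : (shiftedLog z).re = 4 - Real.log ‖1 - z‖ := by
  simp [shiftedLog, log_re]

theorem one_sub_norm_le (z : ℂ) : 1 - ‖z‖ ≤ ‖1 - z‖ := by
  simpa using norm_sub_norm_le (1 : ℂ) z

theorem norm_one_sub_pos {z : ℂ} (hz : ‖z‖ < 1) : 0 < ‖1 - z‖ := by
  linarith [one_sub_norm_le z]

/-- The shift `4` leaves room for `|1 - z| ≤ 2`. As `3 > e`, the iterated logarithm has real part at
least `1`, so division by it is harmless. -/
theorem three_le_sub_log {z : ℂ} (hz : ‖z‖ < 1) : 3 ≤ 4 - Real.log ‖1 - z‖ := by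
  have h2 : ‖1 - z‖ ≤ 2 := by
    have := norm_sub_le (1 : ℂ) z
    rw [norm_one] at this
    linarith
  have := Real.log_le_sub_one_of_pos (norm_one_sub_pos hz)
  linarith

theorem sub_log_le_norm_shiftedLog (z : ℂ) : 4 - Real.log ‖1 - z‖ ≤ ‖shiftedLog z‖ := by
  rw [← shiftedLog_re]
  exact (le_abs_self _).trans (abs_re_le_norm _)

theorem one_le_log_of_three_le {s : ℝ} (hs : 3 ≤ s) : 1 ≤ Real.log s := by
  rw [Real.le_log_iff_exp_le (by linarith)]
  linarith [Real.exp_one_lt_d9]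

theorem log_sub_log_le_norm_log_shiftedLog {z : ℂ} (hz : ‖z‖ < 1) :
    Real.log (4 - Real.log ‖1 - z‖) ≤ ‖Complex.log (shiftedLog z)‖ := by
  have h3 := three_le_sub_log hz
  calc Real.log (4 - Real.log ‖1 - z‖) ≤ Real.log ‖shiftedLog z‖ :=
        Real.log_le_log (by linarith) (sub_log_le_norm_shiftedLog z)
    _ = (Complex.log (shiftedLog z)).re := (log_re _).symm
    _ ≤ _ := (le_abs_self _).trans (abs_re_le_norm _)

theorem one_sub_ne_zero {z : ℂ} (hz : ‖z‖ < 1) : 1 - z ≠ 0 :=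
  norm_pos_iff.1 (norm_one_sub_pos hz)

theorem shiftedLog_ne_zero {z : ℂ} (hz : ‖z‖ < 1) : shiftedLog z ≠ 0 :=
  norm_pos_iff.1 (by linarith [three_le_sub_log hz, sub_log_le_norm_shiftedLog z])

theorem log_shiftedLog_ne_zero {z : ℂ} (hz : ‖z‖ < 1) : Complex.log (shiftedLog z) ≠ 0 :=
  norm_pos_iff.1 (by
    linarith [one_le_log_of_three_le (three_le_sub_log hz), log_sub_log_le_norm_log_shiftedLog hz])

theorem hasDerivAt_shiftedLog {z : ℂ} (hz : ‖z‖ < 1) :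
    HasDerivAt shiftedLog (1 / (1 - z)) z := by
  have hslit : 1 - z ∈ slitPlane := by
    refine Or.inl ?_
    have := (le_abs_self z.re).trans (abs_re_le_norm z)
    simp only [sub_re, one_re]
    linarith
  have h := (((hasDerivAt_id z).const_sub 1).clog hslit).const_sub 4
  refine h.congr_deriv ?_
  simp [neg_div]

theorem hasDerivAt_log_shiftedLog {z : ℂ} (hz : ‖z‖ < 1) :
    HasDerivAt (fun z => Complex.log (shiftedLog z)) (1 / (1 - z) / shiftedLog z) z := by
  refine (hasDerivAt_shiftedLog hz).clog (Or.inl ?_)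
  rw [shiftedLog_re]
  linarith [three_le_sub_log hz]

theorem hasDerivAt_deriv_log_shiftedLog {z : ℂ} (hz : ‖z‖ < 1) :
    HasDerivAt (fun z => 1 / (1 - z) / shiftedLog z)
      ((shiftedLog z - 1) / ((1 - z) ^ 2 * shiftedLog z ^ 2)) z := by
  have h1 := one_sub_ne_zero hz
  have h2 := shiftedLog_ne_zero hz
  have hd1 : HasDerivAt (fun z : ℂ => 1 - z) (-1) z := by
    simpa using (hasDerivAt_id z).const_sub 1
  have hd := (((hasDerivAt_const z (1 : ℂ)).div hd1 h1).div (hasDerivAt_shiftedLog hz) h2)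
  refine hd.congr_deriv ?_
  simp only [Pi.div_apply]
  field_simp
  ring

/-- The coefficient `-f'' / f` for `f = log (4 - log (1 - z))`. -/
noncomputable def logLogCoefficient (z : ℂ) : ℂ :=
  -((shiftedLog z - 1) / ((1 - z) ^ 2 * shiftedLog z ^ 2 * Complex.log (shiftedLog z)))

theorem differentiableOn_logLogCoefficient : DifferentiableOn ℂ logLogCoefficient unitDisc := by
  intro z hz
  have hz := norm_lt_one_of_mem hz
  have h1 := (hasDerivAt_shiftedLog hz).differentiableAt
  have h2 := (hasDerivAt_log_shiftedLog hz).differentiableAt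
  refine DifferentiableAt.differentiableWithinAt ?_
  unfold logLogCoefficient
  refine DifferentiableAt.neg (DifferentiableAt.div (h1.sub_const 1) (by fun_prop) ?_)
  exact mul_ne_zero (mul_ne_zero (pow_ne_zero 2 (one_sub_ne_zero hz))
    (pow_ne_zero 2 (shiftedLog_ne_zero hz))) (log_shiftedLog_ne_zero hz)

theorem isSolution_log_shiftedLog :
    IsSolution logLogCoefficient fun z => Complex.log (shiftedLog z) := by
  refine ⟨fun z hz => (hasDerivAt_log_shiftedLog
    (norm_lt_one_of_mem hz)).differentiableAt.differentiableWithinAt, fun z hz => ?_⟩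
  have hz1 := norm_lt_one_of_mem hz
  have heq : deriv (fun z => Complex.log (shiftedLog z)) =ᶠ[𝓝 z]
      fun z => 1 / (1 - z) / shiftedLog z := by
    filter_upwards [Metric.isOpen_ball.mem_nhds hz] with w hw
    exact (hasDerivAt_log_shiftedLog (norm_lt_one_of_mem hw)).deriv
  rw [heq.deriv_eq, (hasDerivAt_deriv_log_shiftedLog hz1).deriv, logLogCoefficient]
  have h1 := one_sub_ne_zero hz1
  have h2 := shiftedLog_ne_zero hz1
  have h3 := log_shiftedLog_ne_zero hz1
  field_simp
  ring

/-- Passing from `y` to `x` multiplies each of the two logarithmic factors by at most `y / x`, since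
`y / x ≥ 1 + (t - s)` while `s` and `log s` are at least `1`. The square `x ^ 2` pays for both. -/
theorem sq_mul_sub_log_mul_log_le {x y : ℝ} (hx : 0 < x) (hxy : x ≤ y)
    (hs : 3 ≤ 4 - Real.log y) :
    x ^ 2 * ((4 - Real.log x) * Real.log (4 - Real.log x)) ≤
      y ^ 2 * ((4 - Real.log y) * Real.log (4 - Real.log y)) := by
  have hy := hx.trans_le hxy
  have hst : 4 - Real.log y ≤ 4 - Real.log x := by linarith [Real.log_le_log hx hxy]
  have hyx : 1 + ((4 - Real.log x) - (4 - Real.log y)) ≤ y / x := by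
    have := Real.add_one_le_exp (Real.log y - Real.log x)
    rw [Real.exp_sub, Real.exp_log hy, Real.exp_log hx] at this
    linarith
  have hlog1 := one_le_log_of_three_le hs
  set t := 4 - Real.log x
  set s := 4 - Real.log y
  have h1 : t ≤ s * (y / x) := by nlinarith
  have h2 : Real.log t ≤ Real.log s * (y / x) := by
    have h3 : Real.log (t / s) ≤ t / s - 1 :=
      Real.log_le_sub_one_of_pos (div_pos (by linarith) (by linarith))
    rw [Real.log_div (by linarith) (by linarith)] at h3
    have h4 : t / s - 1 ≤ t - s := by
      rw [div_sub_one (by linarith), div_le_iff₀ (by linarith)]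
      nlinarith
    nlinarith
  have hlogt : 0 ≤ Real.log t := Real.log_nonneg (by linarith)
  calc x ^ 2 * (t * Real.log t) ≤ x ^ 2 * ((s * (y / x)) * (Real.log s * (y / x))) := by
        have : 0 ≤ s * (y / x) := by
          have : 0 ≤ y / x := by positivity
          nlinarith
        gcongr
    _ = y ^ 2 * (s * Real.log s) := by field_simp

theorem logLogCondition_logLogCoefficient : LogLogCondition logLogCoefficient := by
  -- `8 = 2 * 4`: the `2` comes from `|ℓ - 1| ≤ 2 |ℓ|` with `ℓ = shiftedLog z`, the `4` from `(1 -
  -- |z|²)² ≤ 4 (1 - |z|)²`.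
  refine ⟨8, ?_⟩
  rintro _ ⟨z, hz, rfl⟩
  have hz := norm_lt_one_of_mem hz
  simp only [log_exp_one_div hz]
  have hx : 0 < 1 - ‖z‖ := by linarith
  have hxy := one_sub_norm_le z
  have hy := norm_one_sub_pos hz
  have hs := three_le_sub_log hz
  have hkey := sq_mul_sub_log_mul_log_le hx hxy hs
  have hls := one_le_log_of_three_le hs
  have hl1 := sub_log_le_norm_shiftedLog z
  have hl2 := log_sub_log_le_norm_log_shiftedLog hz
  have hL := one_le_one_sub_log (norm_nonneg z) hz
  have hA : ‖logLogCoefficient z‖ ≤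
      2 / (‖1 - z‖ ^ 2 * ((4 - Real.log ‖1 - z‖) * Real.log (4 - Real.log ‖1 - z‖))) := by
    have hnum : ‖shiftedLog z - 1‖ ≤ 2 * ‖shiftedLog z‖ := by
      have := norm_sub_le (shiftedLog z) 1
      rw [norm_one] at this
      linarith
    have hpos : 0 < ‖shiftedLog z‖ := by linarith
    have hpos' : 0 < ‖Complex.log (shiftedLog z)‖ := by linarith
    rw [logLogCoefficient, norm_neg, norm_div, norm_mul, norm_mul, norm_pow, norm_pow]
    calc _ ≤ 2 * ‖shiftedLog z‖ /
          (‖1 - z‖ ^ 2 * ‖shiftedLog z‖ ^ 2 * ‖Complex.log (shiftedLog z)‖) := by gcongr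
      _ = 2 / (‖1 - z‖ ^ 2 * (‖shiftedLog z‖ * ‖Complex.log (shiftedLog z)‖)) := by field_simp
      _ ≤ _ := by
        have : 0 < 4 - Real.log ‖1 - z‖ := by linarith
        have : 0 < Real.log (4 - Real.log ‖1 - z‖) := by linarith
        gcongr
  set D := ‖1 - z‖ ^ 2 * ((4 - Real.log ‖1 - z‖) * Real.log (4 - Real.log ‖1 - z‖)) with hD
  have hD0 : 0 < D :=
    mul_pos (by positivity) (mul_pos (by linarith) (by linarith))
  have hLt : (1 - Real.log (1 - ‖z‖)) * Real.log (1 - Real.log (1 - ‖z‖)) ≤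
      (4 - Real.log (1 - ‖z‖)) * Real.log (4 - Real.log (1 - ‖z‖)) :=
    mul_le_mul (by linarith) (Real.log_le_log (by linarith) (by linarith))
      (Real.log_nonneg hL) (by linarith)
  have hsq : (1 - ‖z‖ ^ 2) ^ 2 ≤ 4 * (1 - ‖z‖) ^ 2 := by
    have h1 : 1 - ‖z‖ ^ 2 ≤ 2 * (1 - ‖z‖) := by nlinarith
    have h0 : 0 ≤ 1 - ‖z‖ ^ 2 := by nlinarith [norm_nonneg z]
    nlinarith
  have hLL : 0 ≤ (1 - Real.log (1 - ‖z‖)) * Real.log (1 - Real.log (1 - ‖z‖)) :=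
    mul_nonneg (by linarith) (Real.log_nonneg hL)
  calc ‖logLogCoefficient z‖ * (1 - ‖z‖ ^ 2) ^ 2 * (1 - Real.log (1 - ‖z‖)) *
        Real.log (1 - Real.log (1 - ‖z‖))
      = ‖logLogCoefficient z‖ * ((1 - ‖z‖ ^ 2) ^ 2 *
        ((1 - Real.log (1 - ‖z‖)) * Real.log (1 - Real.log (1 - ‖z‖)))) := by ring
    _ ≤ 2 / D * (4 * (1 - ‖z‖) ^ 2 *
        ((4 - Real.log (1 - ‖z‖)) * Real.log (4 - Real.log (1 - ‖z‖)))) := by gcongr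
    _ = 8 / D * ((1 - ‖z‖) ^ 2 *
        ((4 - Real.log (1 - ‖z‖)) * Real.log (4 - Real.log (1 - ‖z‖)))) := by ring
    _ ≤ 8 / D * D := by gcongr
    _ = 8 := by field_simp

theorem not_isBounded_log_shiftedLog :
    ¬ Bornology.IsBounded ((fun z => Complex.log (shiftedLog z)) '' unitDisc) := by
  intro hb
  obtain ⟨C, hC⟩ := hb.exists_norm_le
  -- At `z = 1 - exp (-N)` the modulus is at least `log (4 + N) > C + 1`.
  set N := Real.exp (C + 1) with hN
  have hN0 : 0 < N := Real.exp_pos _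
  have hlt : Real.exp (-N) < 1 := by simpa using Real.exp_lt_exp.2 (by linarith : -N < 0)
  have hpos := Real.exp_pos (-N)
  have hz : ‖((1 - Real.exp (-N) : ℝ) : ℂ)‖ < 1 := by
    rw [norm_real, Real.norm_eq_abs, abs_of_pos (by linarith)]
    linarith
  have h := hC _ ⟨((1 - Real.exp (-N) : ℝ) : ℂ), by simpa using hz, rfl⟩
  have h' := log_sub_log_le_norm_log_shiftedLog hz
  have hnorm : ‖1 - ((1 - Real.exp (-N) : ℝ) : ℂ)‖ = Real.exp (-N) := by
    rw [← ofReal_one, ← ofReal_sub, norm_real, Real.norm_eq_abs, abs_of_pos (by linarith)]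
    ring
  rw [hnorm, Real.log_exp] at h'
  have h3 : C + 1 ≤ Real.log (4 - -N) := by
    rw [Real.le_log_iff_exp_le (by linarith)]
    linarith
  linarith

theorem mainTheorem10 :
    (∀ A : ℂ → ℂ, DifferentiableOn ℂ A unitDisc → LogLogCondition A →
      ∀ f : ℂ → ℂ, IsSolution A f → IsVMOA f) ∧
    (∃ A f : ℂ → ℂ, DifferentiableOn ℂ A unitDisc ∧ LogLogCondition A ∧ IsSolution A f ∧
      ¬ Bornology.IsBounded (f '' unitDisc)) :=
  ⟨fun _ _ hA _ hf => isVMOA_of_logLogCondition hA hf,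
    logLogCoefficient, fun z => Complex.log (shiftedLog z), differentiableOn_logLogCoefficient,
    logLogCondition_logLogCoefficient, isSolution_log_shiftedLog, not_isBounded_log_shiftedLog⟩
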